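/- Let $d$ and $\ell$ be positive integers, let $q$ be a prime power, and let $\operatorname{GL}_d(q)$ be the group of invertible $(d\times d)$-matrices over the finite field $\mathbb{F}_q$. Let $\operatorname{CGL}_d(q)$ be the set of all $A\in\operatorname{GL}_d(q)$ that do not have $-1$ as an eigenvalue, and set \[ \operatorname{CGL}_d(q)^{(\ell)}:=\{A_1\cdots A_{\ell}: A_i\in\operatorname{CGL}_d(q)\text{ for }i=1,2,\ldots,\ell\}\subseteq\operatorname{GL}_d(q). \] Then \[ \operatorname{CGL}_d(q)^{(\ell)}= \begin{cases} \operatorname{CGL}_d(q), & \text{if }\ell=1, \\ \operatorname{GL}_d(q), & \text{if }\ell\geq2\text{ and }(d,q)\notin\{(1,2),(1,3),(2,2)\}, \\ \emptyset, & \text{if }\ell\geq2\text{ and }(d,q)=(1,2), \\ \{(1)\}, & \text{if }\ell\geq2\text{ and }(d,q)=(1,3), \\ \left\{\begin{pmatrix}1 & 0 \\ 0 & 1\end{pmatrix},\begin{pmatrix}0 & 1 \\ 1 & 1\end{pmatrix},\begin{pmatrix}1 & 1 \\ 1 & 0\end{pmatrix}\right\}, & \text{if }\ell\geq2\text{ and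 }(d,q)=(2,2). \end{cases} \] -/

import Mathlib

/-- The set of invertible `d × d` matrices over the field `F` that do not have `-1` as an eigenvalue.
(Acting on column vectors, as here, or on row vectors gives the same eigenvalues in `F`.) -/
def CGL (d : ℕ) (F : Type*) [Field F] : Set (Matrix.GeneralLinearGroup (Fin d) F) :=
  {A | ¬ Module.End.HasEigenvalue (Matrix.toLin' (A : Matrix (Fin d) (Fin d) F)) (-1)}

/-- The set of all products `A₁ ⋯ A_ℓ` of exactly `ℓ` matrices from `CGL d F`. -/
def CGLProd (d : ℕ) (F : Type*) [Field F] (ℓ : ℕ) :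
    Set (Matrix.GeneralLinearGroup (Fin d) F) :=
  {A | ∃ B : Fin ℓ → Matrix.GeneralLinearGroup (Fin d) F,
    (∀ i, B i ∈ CGL d F) ∧ A = (List.ofFn B).prod}

/-!
A matrix `X` writes `A ∈ GL_d(q)` as the product `X * (X⁻¹ * A)` of two matrices without eigenvalue
`-1` as soon as `X`, `X + 1` and `X + A` are invertible (`mem_CGLProd_two_of_shiftable`). The
existence of such an `X` makes sense for every square matrix `A`, it is invariant under conjugation
and transposition, and it passes from the diagonal blocks of `A` to `A`: if `Y` and `Z` serve for the
blocks, the block upper triangular matrix with diagonal `Y`, `Z` and with minus the upper right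
block of `A` in the corner serves for `A` (`Shiftable.fromBlocks`). So it suffices to treat all
matrices, invertible or not, of a few small sizes.

For `q ≥ 4` size `1` is enough. For `q = 3` sizes `2` and `3` are; a `3 × 3` matrix splits as `1 + 2`
after a conjugation that changes its diagonal (`Shiftable.exists_conj_diag_ne`), unless it is scalar.
For `q = 2` sizes `3`, `4` and `5` are. Here a `2 × 2` block of trace `1` can be split off whenever
two diagonal entries differ, which conjugation achieves for matrices that are not scalar. In size
`4` the complementary block can be one of the six `2 × 2` matrices that do not admit an `X`; then the
freedom in the upper right corner of `X` is used instead of spending it on block triangularity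
(`shiftable_fromBlocks_of_lower_ne_zero`).

In the exceptional cases `CGL_d(q)` is empty, trivial, or consists of the two elements of order
three in `GL_2(2)`.
-/

/-! ### Invertible shifts and block decompositions -/

/-- `X`, `X + 1` and `X + A` are all invertible for some `X`. For invertible `A` this says that `A`
is a product of two matrices without eigenvalue `-1`, but the notion is useful for all square
matrices because it passes from diagonal blocks to the whole matrix. -/
def Shiftable {n F : Type*} [Fintype n] [DecidableEq n] [CommRing F] (A : Matrix n n F) : Prop :=
  ∃ X : Matrix n n F, X.det ≠ 0 ∧ (X + 1).det ≠ 0 ∧ (X + A).det ≠ 0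

namespace Shiftable

open Matrix

variable {m n F : Type*} [Fintype m] [DecidableEq m] [Fintype n] [DecidableEq n] [Field F]

theorem of_submatrix_equiv {A : Matrix n n F} (e : m ≃ n) (h : Shiftable (A.submatrix e e)) :
    Shiftable A := by
  obtain ⟨X, h1, h2, h3⟩ := h
  refine ⟨X.submatrix e.symm e.symm, by simpa using h1, ?_, ?_⟩
  · rw [← det_submatrix_equiv_self e]
    simpa [submatrix_add, Pi.add_apply] using h2
  · rw [← det_submatrix_equiv_self e]
    simpa [submatrix_add, Pi.add_apply] using h3

theorem of_transpose {A : Matrix n n F} (h : Shiftable Aᵀ) : Shiftable A := by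
  obtain ⟨X, h1, h2, h3⟩ := h
  refine ⟨Xᵀ, by simpa using h1, ?_, ?_⟩
  · rw [← det_transpose]; simpa using h2
  · rw [← det_transpose]; simpa using h3

theorem of_conj {A P Q : Matrix n n F} (hQP : Q * P = 1) (h : Shiftable (P * A * Q)) :
    Shiftable A := by
  obtain ⟨X, h1, h2, h3⟩ := h
  have key : ∀ Y : Matrix n n F, (Q * Y * P).det = Y.det := fun Y ↦ by
    rw [det_mul, det_mul, mul_right_comm, ← det_mul, hQP, det_one, one_mul]
  refine ⟨Q * X * P, by rwa [key], ?_, ?_⟩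
  · rw [← key] at h2
    rwa [mul_add, add_mul, mul_one, hQP] at h2
  · rw [← key] at h3
    have : Q * (P * A * Q) * P = A := by
      calc Q * (P * A * Q) * P = (Q * P) * A * (Q * P) := by simp only [Matrix.mul_assoc]
        _ = A := by simp [hQP]
    rwa [mul_add, add_mul, this] at h3

/-- If the diagonal blocks are handled by `Y` and `Z`, cancelling the upper right block of `A` makes
all three matrices block triangular. -/
theorem fromBlocks {A : Matrix m m F} {D : Matrix n n F} (hA : Shiftable A) (hD : Shiftable D)
    (B : Matrix m n F) (C : Matrix n m F) : Shiftable (Matrix.fromBlocks A B C D) := by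
  obtain ⟨Y, h1, h2, h3⟩ := hA
  obtain ⟨Z, k1, k2, k3⟩ := hD
  refine ⟨Matrix.fromBlocks Y (-B) 0 Z, ?_, ?_, ?_⟩
  · rw [det_fromBlocks_zero₂₁]; exact mul_ne_zero h1 k1
  · rw [← fromBlocks_one, fromBlocks_add, add_zero, add_zero,
      det_fromBlocks_zero₂₁]
    exact mul_ne_zero h2 k2
  · rw [fromBlocks_add, neg_add_cancel, det_fromBlocks_zero₁₂]
    exact mul_ne_zero h3 k3

theorem of_sum {A : Matrix (m ⊕ n) (m ⊕ n) F} (h₁ : Shiftable A.toBlocks₁₁)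
    (h₂ : Shiftable A.toBlocks₂₂) : Shiftable A := by
  rw [← fromBlocks_toBlocks A]
  exact h₁.fromBlocks h₂ _ _

theorem of_subtype {A : Matrix n n F} (p : n → Prop) [DecidablePred p]
    [Fintype {i // p i}] [Fintype {i // ¬ p i}]
    (h₁ : Shiftable (A.submatrix (Subtype.val : {i // p i} → n) Subtype.val))
    (h₂ : Shiftable (A.submatrix (Subtype.val : {i // ¬ p i} → n) Subtype.val)) :
    Shiftable A :=
  of_submatrix_equiv (Equiv.sumCompl p) (of_sum h₁ h₂)

theorem map_ringEquiv {K : Type*} [Field K] (e : K ≃+* F) {A : Matrix n n F}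
    (h : Shiftable (A.map e.symm)) : Shiftable A := by
  obtain ⟨X, h1, h2, h3⟩ := h
  have key : ∀ Y : Matrix n n K, Y.det ≠ 0 → (Y.map e).det ≠ 0 := fun Y hY ↦ by
    have := (e : K →+* F).map_det Y
    simp only [RingHom.mapMatrix_apply, RingEquiv.coe_toRingHom] at this
    rw [← this]
    simpa using hY
  refine ⟨X.map e, key _ h1, ?_, ?_⟩
  · convert key _ h2 using 2
    rw [Matrix.map_add _ (map_add e), Matrix.map_one _ (map_zero e) (map_one e)]
  · convert key _ h3 using 2
    rw [Matrix.map_add _ (map_add e)]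
    ext; simp

/-- Conjugation by a transvection changes two diagonal entries of a matrix with a nonzero
off-diagonal entry, and no others; with three or more diagonal entries they can thus be made
unequal. -/
theorem exists_conj_diag_ne {A : Matrix n n F} (hn : 3 ≤ Fintype.card n)
    (hA : ∀ c, A ≠ scalar n c) :
    ∃ P Q : Matrix n n F, Q * P = 1 ∧ ∃ i j, (P * A * Q) i i ≠ (P * A * Q) j j := by
  by_cases hd : ∃ i j, A i i ≠ A j j
  · exact ⟨1, 1, by simp, by simpa using hd⟩
  push Not at hd
  obtain ⟨i, j, hij, ha⟩ : ∃ i j, i ≠ j ∧ A i j ≠ 0 := by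
    by_contra! h
    obtain ⟨i₀⟩ : Nonempty n := Fintype.card_pos_iff.1 (by omega)
    refine hA (A i₀ i₀) ?_
    ext i j
    by_cases hij : i = j
    · subst hij; simp [hd i i₀]
    · simp [hij, h i j hij]
  obtain ⟨k, hk⟩ : ∃ k, k ∉ ({i, j} : Finset n) := by
    by_contra! h
    have := (Finset.card_le_card (fun x _ ↦ h x : Finset.univ ⊆ {i, j})).trans Finset.card_le_two
    rw [Finset.card_univ] at this
    omega
  simp only [Finset.mem_insert, Finset.mem_singleton, not_or] at hk
  refine ⟨transvection j i 1, transvection j i (-1), ?_, i, k, ?_⟩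
  · rw [transvection_mul_transvection_same _ _ hij.symm]; simp
  · rw [mul_transvection_apply_same, mul_transvection_apply_of_ne _ _ _ _ hk.1,
      transvection_mul_apply_of_ne _ _ _ _ hij, transvection_mul_apply_of_ne _ _ _ _ hij,
      transvection_mul_apply_of_ne _ _ _ _ hk.2, hd k i]
    simpa using ha

end Shiftable

/-- Every `d × d` matrix over `F`, invertible or not, is shiftable. -/
def AllShiftable (d : ℕ) (F : Type*) [Field F] : Prop :=
  ∀ A : Matrix (Fin d) (Fin d) F, Shiftable A

namespace AllShiftable

open Matrix

variable {F : Type*} [Field F]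

theorem shiftable {d : ℕ} (h : AllShiftable d F) {n : Type*} [Fintype n] [DecidableEq n]
    (hn : Fintype.card n = d) (A : Matrix n n F) : Shiftable A :=
  Shiftable.of_submatrix_equiv (Fintype.equivFinOfCardEq hn).symm (h _)

theorem add {a b : ℕ} (ha : AllShiftable a F) (hb : AllShiftable b F) :
    AllShiftable (a + b) F := fun _ ↦
  Shiftable.of_submatrix_equiv finSumFinEquiv (Shiftable.of_sum (ha _) (hb _))

theorem of_ringEquiv {K : Type*} [Field K] (e : K ≃+* F) {d : ℕ} (h : AllShiftable d K) :
    AllShiftable d F := fun _ ↦ Shiftable.map_ringEquiv e (h _)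

end AllShiftable

theorem shiftable_of_card_eq_one {n F : Type*} [Fintype n] [DecidableEq n] [Field F]
    (hn : Fintype.card n = 1) {A : Matrix n n F} (i : n) {x : F} (h0 : x ≠ 0) (h1 : x + 1 ≠ 0)
    (hA : x + A i i ≠ 0) : Shiftable A := by
  have : Subsingleton n := Fintype.card_le_one_iff_subsingleton.1 hn.le
  refine ⟨Matrix.scalar n x, ?_, ?_, ?_⟩ <;>
    simpa [Matrix.det_eq_elem_of_subsingleton _ i]

/-- With at least four elements in `F`, the three forbidden values `0, -1, -a` leave one over in
each diagonal position. -/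
theorem allShiftable_of_four_le_card {F : Type*} [Field F] [Finite F] (hF : 4 ≤ Nat.card F) {d : ℕ}
    (hd : 1 ≤ d) : AllShiftable d F := by
  have one : AllShiftable 1 F := by
    intro A
    classical
    have := Fintype.ofFinite F
    obtain ⟨x, hx⟩ : ∃ x, x ∉ ({0, -1, -A 0 0} : Finset F) := by
      by_contra! h
      have := (Finset.card_le_card
        (fun x _ ↦ h x : Finset.univ ⊆ ({0, -1, -A 0 0} : Finset F))).trans Finset.card_le_three
      rw [Finset.card_univ, ← Nat.card_eq_fintype_card] at this
      omega
    simp only [Finset.mem_insert, Finset.mem_singleton, not_or, eq_neg_iff_add_eq_zero] at hx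
    exact shiftable_of_card_eq_one (by simp) 0 hx.1 hx.2.1 hx.2.2
  induction d, hd using Nat.le_induction with
  | base => exact one
  | succ d _ ih => exact ih.add one

/-! ### The field with three elements -/

section ThreeElements

open Matrix

theorem allShiftable_two_zmod_three : AllShiftable 2 (ZMod 3) := by
  intro A
  obtain ⟨x, y, z, w, h1, h2, h3⟩ : ∃ x y z w : ZMod 3, x * w - y * z ≠ 0 ∧
      (x + 1) * (w + 1) - y * z ≠ 0 ∧
      (x + A 0 0) * (w + A 1 1) - (y + A 0 1) * (z + A 1 0) ≠ 0 := by
    generalize A 0 0 = a, A 0 1 = b, A 1 0 = c, A 1 1 = d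
    revert a b c d
    decide +kernel
  exact ⟨!![x, y; z, w], by simpa [det_fin_two], by simpa [det_fin_two], by simpa [det_fin_two]⟩

/-- A matrix that is not scalar has, after conjugation, a diagonal entry different from `-1`, which
`1` shifts to a unit. The same holds for scalar matrices other than `-1`; for `-1` the companion
matrix of a cubic without roots does it. -/
theorem allShiftable_three_zmod_three : AllShiftable 3 (ZMod 3) := by
  have of_diag_ne (A : Matrix (Fin 3) (Fin 3) (ZMod 3)) (i : Fin 3) (h : A i i ≠ -1) :
      Shiftable A := by
    refine Shiftable.of_subtype (· = i) ?_ ?_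
    · refine shiftable_of_card_eq_one (x := 1) (by simp) ⟨i, rfl⟩ (by decide) (by decide) ?_
      rwa [add_comm, Ne, ← eq_neg_iff_add_eq_zero]
    · exact allShiftable_two_zmod_three.shiftable (by simp [Fintype.card_subtype_compl]) _
  intro A
  by_cases hA : ∃ c, A = scalar (Fin 3) c
  · obtain ⟨c, rfl⟩ := hA
    by_cases hc : c = -1
    · subst hc
      refine ⟨!![0, 0, -1; 1, 0, 1; 0, 1, 0], ?_, ?_, ?_⟩ <;>
        · simp [det_fin_three]
          try decide
    · exact of_diag_ne _ 0 (by simpa using hc)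
  · push Not at hA
    obtain ⟨P, Q, hQP, i, j, hij⟩ := Shiftable.exists_conj_diag_ne (by simp) hA
    refine Shiftable.of_conj hQP ?_
    by_cases hi : (P * A * Q) i i = -1
    · exact of_diag_ne _ j (hi ▸ hij.symm)
    · exact of_diag_ne _ i hi

theorem allShiftable_zmod_three {d : ℕ} (hd : 2 ≤ d) : AllShiftable d (ZMod 3) := by
  induction d using Nat.strong_induction_on with
  | _ d ih =>
    obtain rfl | rfl | h : d = 2 ∨ d = 3 ∨ 4 ≤ d := by omega
    · exact allShiftable_two_zmod_three
    · exact allShiftable_three_zmod_three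
    · obtain ⟨k, rfl⟩ := Nat.exists_eq_add_of_le' h
      exact (ih (k + 2) (by omega) (by omega)).add allShiftable_two_zmod_three

end ThreeElements

/-! ### The field with two elements -/

section TwoElements

open Matrix

/-- Over the field with two elements a `2 × 2` matrix is shiftable if it is scalar or has
trace `1`. (The remaining six are not, so they have to be avoided as diagonal blocks.) -/
theorem shiftable_fin_two {A : Matrix (Fin 2) (Fin 2) (ZMod 2)}
    (h : A 0 0 + A 1 1 = 1 ∨ A 0 1 = 0 ∧ A 1 0 = 0 ∧ A 0 0 = A 1 1) : Shiftable A := by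
  obtain ⟨x, y, z, w, h1, h2, h3⟩ : ∃ x y z w : ZMod 2, x * w - y * z ≠ 0 ∧
      (x + 1) * (w + 1) - y * z ≠ 0 ∧
      (x + A 0 0) * (w + A 1 1) - (y + A 0 1) * (z + A 1 0) ≠ 0 := by
    revert h
    generalize A 0 0 = a, A 0 1 = b, A 1 0 = c, A 1 1 = d
    revert a b c d
    decide +kernel
  exact ⟨!![x, y; z, w], by simpa [det_fin_two], by simpa [det_fin_two], by simpa [det_fin_two]⟩

theorem shiftable_of_trace_eq_one {n : Type*} [Fintype n] [DecidableEq n]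
    (hn : Fintype.card n = 2) {A : Matrix n n (ZMod 2)} (h : A.trace = 1) : Shiftable A := by
  have e := (Fintype.equivFinOfCardEq hn).symm
  refine Shiftable.of_submatrix_equiv e (shiftable_fin_two (Or.inl ?_))
  rw [← h, trace, ← Equiv.sum_comp e]
  simp

theorem allShiftable_three_zmod_two : AllShiftable 3 (ZMod 2) := by
  intro A
  -- Ten of the 48 matrices with irreducible characteristic polynomial suffice.
  obtain ⟨X, -, hX⟩ : ∃ X ∈ ([!![0, 0, 1; 0, 1, 1; 1, 1, 0], !![0, 1, 0; 1, 0, 1; 1, 0, 0],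
      !![0, 1, 1; 1, 1, 1; 0, 1, 0], !![1, 0, 1; 1, 0, 0; 0, 1, 1], !![0, 0, 1; 1, 0, 0; 0, 1, 1],
      !![0, 1, 0; 1, 1, 1; 1, 1, 0], !![0, 1, 0; 0, 0, 1; 1, 1, 0], !![1, 0, 1; 1, 1, 0; 1, 1, 1],
      !![0, 0, 1; 0, 1, 1; 1, 1, 1], !![0, 0, 1; 1, 0, 0; 1, 1, 0]] :
        List (Matrix (Fin 3) (Fin 3) (ZMod 2))),
      X.det ≠ 0 ∧ (X + 1).det ≠ 0 ∧ (X + A).det ≠ 0 := by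
    simp only [det_fin_three, Matrix.add_apply, one_apply]
    generalize A 0 0 = a, A 0 1 = b, A 0 2 = c, A 1 0 = d, A 1 1 = e, A 1 2 = f, A 2 0 = g,
      A 2 1 = h, A 2 2 = i
    revert a b c d e f g h i
    decide +kernel
  exact ⟨X, hX⟩

theorem ZMod.add_eq_one_of_ne {a b : ZMod 2} (h : a ≠ b) : a + b = 1 := by
  revert a b; decide

/-- A diagonal block of trace `1` can be split off as soon as two diagonal entries differ. -/
theorem shiftable_of_diag_ne {n : Type*} [Fintype n] [DecidableEq n] {A : Matrix n n (ZMod 2)}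
    {i j : n} (hij : A i i ≠ A j j)
    (h : Shiftable (A.submatrix (Subtype.val : {k // ¬ (k = i ∨ k = j)} → n) Subtype.val)) :
    Shiftable A := by
  have hne : i ≠ j := fun h ↦ hij (h ▸ rfl)
  refine Shiftable.of_subtype (fun k ↦ k = i ∨ k = j) ?_ h
  have hp : ∀ k, k ∈ ({i, j} : Finset n) ↔ k = i ∨ k = j := by simp
  refine shiftable_of_trace_eq_one ?_ ?_
  · rw [Fintype.card_of_subtype _ hp, Finset.card_pair hne]
  · rw [trace]
    simp only [diag_apply, submatrix_apply]
    rw [← Finset.sum_subtype _ hp (fun k ↦ A k k), Finset.sum_pair hne,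
      ZMod.add_eq_one_of_ne hij]

set_option synthInstance.maxSize 512 in
/-- For fixed `Z` the matrix `Z + S` may be singular, but adding suitable columns from the range of
`R ≠ 0` makes it invertible for one of the two admissible `Z`. -/
theorem exists_completion (S R : Matrix (Fin 2) (Fin 2) (ZMod 2)) (hR : R ≠ 0) :
    ∃ Z E : Matrix (Fin 2) (Fin 2) (ZMod 2),
      Z.det ≠ 0 ∧ (Z + 1).det ≠ 0 ∧ (Z + S - R * E).det ≠ 0 := by
  have hR' : ¬ (R 0 0 = 0 ∧ R 0 1 = 0 ∧ R 1 0 = 0 ∧ R 1 1 = 0) := fun ⟨h1, h2, h3, h4⟩ ↦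
    hR (by ext i j; fin_cases i <;> fin_cases j <;> assumption)
  obtain ⟨x, y, z, w, h1, h2, p, q, r, s, h3⟩ : ∃ x y z w : ZMod 2, x * w - y * z ≠ 0 ∧
      (x + 1) * (w + 1) - y * z ≠ 0 ∧ ∃ p q r s : ZMod 2,
      (x + S 0 0 - (R 0 0 * p + R 0 1 * r)) * (w + S 1 1 - (R 1 0 * q + R 1 1 * s)) -
      (y + S 0 1 - (R 0 0 * q + R 0 1 * s)) * (z + S 1 0 - (R 1 0 * p + R 1 1 * r)) ≠ 0 := by
    revert hR'
    generalize S 0 0 = a, S 0 1 = b, S 1 0 = c, S 1 1 = d, R 0 0 = e, R 0 1 = f, R 1 0 = g,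
      R 1 1 = h
    revert a b c d e f g h
    decide +kernel
  exact ⟨!![x, y; z, w], !![p, q; r, s], by simpa [det_fin_two], by simpa [det_fin_two],
    by simpa [det_fin_two, mul_apply] using h3⟩

/-- The Schur complement of the upper left block of `X + A` involves the upper right block of `X`
through the lower left block `R` of `A`, so that `R ≠ 0` leaves room for any lower right block `S`,
shiftable or not. -/
theorem shiftable_fromBlocks_of_lower_ne_zero {P Q R S : Matrix (Fin 2) (Fin 2) (ZMod 2)}
    (hP : Shiftable P) (hR : R ≠ 0) : Shiftable (fromBlocks P Q R S) := by
  obtain ⟨Y, h1, h2, h3⟩ := hP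
  have hu : IsUnit (Y + P).det := h3.isUnit
  have hR' : R * (Y + P)⁻¹ ≠ 0 := fun h ↦ hR (by
    rw [← Matrix.mul_one R, ← nonsing_inv_mul _ hu, ← Matrix.mul_assoc, h, Matrix.zero_mul])
  obtain ⟨Z, E, k1, k2, k3⟩ := exists_completion S _ hR'
  have : Invertible (Y + P) := invertibleOfIsUnitDet _ hu
  refine ⟨fromBlocks Y (E - Q) 0 Z, ?_, ?_, ?_⟩
  · rw [det_fromBlocks_zero₂₁]; exact mul_ne_zero h1 k1
  · rw [← fromBlocks_one, fromBlocks_add, add_zero, add_zero, det_fromBlocks_zero₂₁]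
    exact mul_ne_zero h2 k2
  · rw [fromBlocks_add, sub_add_cancel, zero_add, det_fromBlocks₁₁, invOf_eq_nonsing_inv]
    exact mul_ne_zero h3 k3

theorem shiftable_fromBlocks_of_offDiag_ne_zero {P Q R S : Matrix (Fin 2) (Fin 2) (ZMod 2)}
    (hP : Shiftable P) (h : R ≠ 0 ∨ Q ≠ 0) : Shiftable (fromBlocks P Q R S) := by
  by_cases hR : R = 0
  · refine Shiftable.of_transpose ?_
    rw [fromBlocks_transpose]
    refine shiftable_fromBlocks_of_lower_ne_zero (Shiftable.of_transpose (by simpa)) ?_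
    simpa using h.resolve_left (not_not.2 hR)
  · exact shiftable_fromBlocks_of_lower_ne_zero hP hR

/-- The diagonal is `(c', c, c, c)` with `c' ≠ c`. Either the lower right block is scalar, or one of
its off-diagonal entries is nonzero and lies outside the diagonal blocks once the indices are
grouped as `{0, 2}` and `{1, 3}`. -/
theorem shiftable_of_diag_zero_ne {A : Matrix (Fin 4) (Fin 4) (ZMod 2)} (h0 : A 0 0 ≠ A 1 1)
    (h2 : A 2 2 = A 1 1) (h3 : A 3 3 = A 1 1) : Shiftable A := by
  have htr : A 0 0 + A 1 1 = 1 := ZMod.add_eq_one_of_ne h0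
  let e : Fin 2 ⊕ Fin 2 ≃ Fin 4 := finSumFinEquiv
  by_cases hS : A 2 3 = 0 ∧ A 3 2 = 0
  · refine Shiftable.of_submatrix_equiv e (Shiftable.of_sum (shiftable_fin_two (Or.inl htr))
      (shiftable_fin_two (Or.inr ⟨hS.1, hS.2, ?_⟩)))
    exact h2.trans h3.symm
  · refine Shiftable.of_submatrix_equiv (e.trans (Equiv.swap 1 2)) ?_
    rw [← fromBlocks_toBlocks (A.submatrix _ _)]
    refine shiftable_fromBlocks_of_offDiag_ne_zero (shiftable_fin_two (Or.inl ?_)) ?_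
    · change A 0 0 + A 2 2 = 1
      rw [h2, htr]
    · rw [← not_and_or]
      exact fun h ↦ hS ⟨congrFun (congrFun h.2 1) 1, congrFun (congrFun h.1 1) 1⟩

theorem allShiftable_four_zmod_two : AllShiftable 4 (ZMod 2) := by
  have of_diag_ne (A : Matrix (Fin 4) (Fin 4) (ZMod 2)) (i j : Fin 4) (hij : A i i ≠ A j j) :
      Shiftable A := by
    obtain ⟨σ, h, h' | h'⟩ : ∃ σ : Equiv.Perm (Fin 4), A (σ 0) (σ 0) ≠ A (σ 1) (σ 1) ∧
        (A (σ 2) (σ 2) ≠ A (σ 3) (σ 3) ∨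
          A (σ 2) (σ 2) = A (σ 1) (σ 1) ∧ A (σ 3) (σ 3) = A (σ 1) (σ 1)) := by
      have key : ∀ (a b c d : ZMod 2) (i j : Fin 4), ![a, b, c, d] i ≠ ![a, b, c, d] j →
          ∃ σ : Equiv.Perm (Fin 4), ![a, b, c, d] (σ 0) ≠ ![a, b, c, d] (σ 1) ∧
          (![a, b, c, d] (σ 2) ≠ ![a, b, c, d] (σ 3) ∨
            ![a, b, c, d] (σ 2) = ![a, b, c, d] (σ 1) ∧
            ![a, b, c, d] (σ 3) = ![a, b, c, d] (σ 1)) := by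
        decide +kernel
      have hd : ∀ k, ![A 0 0, A 1 1, A 2 2, A 3 3] k = A k k := by
        intro k; fin_cases k <;> rfl
      simpa only [hd] using key (A 0 0) (A 1 1) (A 2 2) (A 3 3) i j (by simpa only [hd] using hij)
    · refine Shiftable.of_submatrix_equiv ((finSumFinEquiv : Fin 2 ⊕ Fin 2 ≃ Fin 4).trans σ)
        (Shiftable.of_sum (shiftable_fin_two (Or.inl (ZMod.add_eq_one_of_ne h)))
          (shiftable_fin_two (Or.inl (ZMod.add_eq_one_of_ne h'))))
    · exact Shiftable.of_submatrix_equiv σ (shiftable_of_diag_zero_ne h h'.1 h'.2)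
  intro A
  by_cases hA : ∃ c, A = scalar (Fin 4) c
  · obtain ⟨c, rfl⟩ := hA
    refine Shiftable.of_submatrix_equiv (finSumFinEquiv : Fin 2 ⊕ Fin 2 ≃ Fin 4)
      (Shiftable.of_sum (shiftable_fin_two (Or.inr ?_)) (shiftable_fin_two (Or.inr ?_))) <;>
    exact ⟨rfl, rfl, rfl⟩
  · push Not at hA
    obtain ⟨P, Q, hQP, i, j, hij⟩ := Shiftable.exists_conj_diag_ne (by simp) hA
    exact Shiftable.of_conj hQP (of_diag_ne _ i j hij)

theorem allShiftable_five_zmod_two : AllShiftable 5 (ZMod 2) := by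
  intro A
  by_cases hA : ∃ c, A = scalar (Fin 5) c
  · obtain ⟨c, rfl⟩ := hA
    exact Shiftable.of_submatrix_equiv (finSumFinEquiv : Fin 2 ⊕ Fin 3 ≃ Fin 5)
      (Shiftable.of_sum (shiftable_fin_two (Or.inr ⟨rfl, rfl, rfl⟩))
        (allShiftable_three_zmod_two _))
  · push Not at hA
    obtain ⟨P, Q, hQP, i, j, hij⟩ := Shiftable.exists_conj_diag_ne (by simp) hA
    refine Shiftable.of_conj hQP (shiftable_of_diag_ne hij ?_)
    refine allShiftable_three_zmod_two.shiftable ?_ _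
    have hne : i ≠ j := fun h ↦ hij (h ▸ rfl)
    have hp : ∀ k, k ∈ ({i, j} : Finset (Fin 5)) ↔ k = i ∨ k = j := by simp
    rw [Fintype.card_subtype_compl, Fintype.card_of_subtype _ hp, Finset.card_pair hne,
      Fintype.card_fin]

theorem allShiftable_zmod_two {d : ℕ} (hd : 3 ≤ d) : AllShiftable d (ZMod 2) := by
  induction d using Nat.strong_induction_on with
  | _ d ih =>
    obtain rfl | rfl | rfl | h : d = 3 ∨ d = 4 ∨ d = 5 ∨ 6 ≤ d := by omega
    · exact allShiftable_three_zmod_two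
    · exact allShiftable_four_zmod_two
    · exact allShiftable_five_zmod_two
    · obtain ⟨k, rfl⟩ := Nat.exists_eq_add_of_le' h
      exact (ih (k + 3) (by omega) (by omega)).add allShiftable_three_zmod_two

end TwoElements

/-! ### Products of matrices without eigenvalue `-1` -/

section Products

open Matrix

variable {F : Type*} [Field F]

theorem mem_CGL_iff {d : ℕ} {A : GeneralLinearGroup (Fin d) F} :
    A ∈ CGL d F ↔ ((A : Matrix (Fin d) (Fin d) F) + 1).det ≠ 0 := by
  rw [CGL, Set.mem_ofPred_eq, not_iff_not, Module.End.hasEigenvalue_iff_mem_spectrum,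
    spectrum_toLin', spectrum.mem_iff, isUnit_iff_isUnit_det, isUnit_iff_ne_zero, not_not,
    map_neg, map_one, ← neg_add', add_comm, det_neg]
  simp

theorem CGLProd_one (d : ℕ) : CGLProd d F 1 = CGL d F := by
  ext A
  constructor
  · rintro ⟨B, hB, rfl⟩
    simpa using hB 0
  · exact fun h ↦ ⟨fun _ ↦ A, fun _ ↦ h, by simp⟩

theorem mem_CGLProd_succ {d ℓ : ℕ} {A : GeneralLinearGroup (Fin d) F} :
    A ∈ CGLProd d F (ℓ + 1) ↔ ∃ B ∈ CGL d F, ∃ C ∈ CGLProd d F ℓ, A = B * C := by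
  constructor
  · rintro ⟨B, hB, rfl⟩
    exact ⟨B 0, hB 0, _, ⟨fun i ↦ B i.succ, fun i ↦ hB _, rfl⟩, by simp [List.ofFn_succ]⟩
  · rintro ⟨B, hB, _, ⟨C, hC, rfl⟩, rfl⟩
    refine ⟨Fin.cons B C, fun i ↦ ?_, by simp [List.ofFn_succ]⟩
    cases i using Fin.cases with
    | zero => simpa using hB
    | succ i => simpa using hC i

/-- `A = X * (X⁻¹ * A)`, where `X⁻¹ * A + 1 = X⁻¹ * (X + A)`. -/
theorem mem_CGLProd_two_of_shiftable {d : ℕ} {A : GeneralLinearGroup (Fin d) F}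
    (h : Shiftable (A : Matrix (Fin d) (Fin d) F)) : A ∈ CGLProd d F 2 := by
  obtain ⟨X, h0, h1, h2⟩ := h
  let Y : GeneralLinearGroup (Fin d) F := GeneralLinearGroup.mkOfDetNeZero X h0
  have hY : (Y : Matrix (Fin d) (Fin d) F) = X := rfl
  refine mem_CGLProd_succ.2 ⟨Y, mem_CGL_iff.2 h1, Y⁻¹ * A, ?_, by simp⟩
  rw [CGLProd_one, mem_CGL_iff]
  have : (X * ((Y⁻¹ * A : GeneralLinearGroup (Fin d) F) + 1)).det ≠ 0 := by
    rw [mul_add, mul_one, ← hY, ← Units.val_mul, mul_inv_cancel_left, add_comm]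
    exact h2
  rw [det_mul] at this
  exact right_ne_zero_of_mul this

theorem CGLProd_eq_univ {d : ℕ} (h : AllShiftable d F) {ℓ : ℕ} (hℓ : 2 ≤ ℓ) :
    CGLProd d F ℓ = Set.univ := by
  induction ℓ, hℓ using Nat.le_induction with
  | base => exact Set.eq_univ_of_forall fun A ↦ mem_CGLProd_two_of_shiftable (h _)
  | succ ℓ _ ih =>
    refine Set.eq_univ_of_forall fun A ↦ ?_
    obtain ⟨X, h0, h1, -⟩ := h 1
    refine mem_CGLProd_succ.2
      ⟨GeneralLinearGroup.mkOfDetNeZero X h0, mem_CGL_iff.2 h1, _, ih ▸ Set.mem_univ _,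
        (mul_inv_cancel_left _ A).symm⟩

theorem allShiftable_of_card [Finite F] {q : ℕ} (hq : Nat.card F = q) {d : ℕ} (hd : 1 ≤ d)
    (h12 : (d, q) ≠ (1, 2)) (h13 : (d, q) ≠ (1, 3)) (h22 : (d, q) ≠ (2, 2)) :
    AllShiftable d F := by
  have := Fintype.ofFinite F
  have h1 : 1 < Nat.card F := Finite.one_lt_card
  simp only [Ne, Prod.mk.injEq, not_and] at h12 h13 h22
  obtain h | h | h : q = 2 ∨ q = 3 ∨ 4 ≤ q := by omega
  · exact (allShiftable_zmod_two (by omega)).of_ringEquiv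
      (ZMod.ringEquivOfPrime F Nat.prime_two (by rw [← Nat.card_eq_fintype_card, hq, h]))
  · exact (allShiftable_zmod_three (by omega)).of_ringEquiv
      (ZMod.ringEquivOfPrime F Nat.prime_three (by rw [← Nat.card_eq_fintype_card, hq, h]))
  · exact allShiftable_of_four_le_card (hq ▸ h) hd

theorem eq_zero_or_one_of_card_eq_two (h : Nat.card F = 2) (x : F) : x = 0 ∨ x = 1 := by
  have := Nat.finite_of_card_ne_zero (α := F) (by omega)
  have := Fintype.ofFinite F
  rw [Nat.card_eq_fintype_card] at h
  let e := ZMod.ringEquivOfPrime F Nat.prime_two h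
  have : ∀ y : ZMod 2, y = 0 ∨ y = 1 := by decide
  exact (this (e.symm x)).imp (fun h ↦ by simpa using h) (fun h ↦ by simpa using h)

theorem eq_zero_or_one_or_neg_one_of_card_eq_three (h : Nat.card F = 3) (x : F) :
    x = 0 ∨ x = 1 ∨ x = -1 := by
  have := Nat.finite_of_card_ne_zero (α := F) (by omega)
  have := Fintype.ofFinite F
  rw [Nat.card_eq_fintype_card] at h
  let e := ZMod.ringEquivOfPrime F Nat.prime_three h
  have : ∀ y : ZMod 3, y = 0 ∨ y = 1 ∨ y = -1 := by decide
  refine (this (e.symm x)).imp (fun h ↦ by simpa using h) (Or.imp (fun h ↦ by simpa using h) ?_)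
  exact fun h ↦ by rw [e.symm_apply_eq] at h; simpa using h

theorem one_add_one_eq_zero_of_card_eq_two (h : Nat.card F = 2) : (1 : F) + 1 = 0 := by
  rcases eq_zero_or_one_of_card_eq_two h (1 + 1 : F) with h | h
  · exact h
  · simp at h

theorem CGL_one_of_card_eq_two (h : Nat.card F = 2) : CGL 1 F = ∅ := by
  refine Set.eq_empty_of_forall_notMem fun A hA ↦ ?_
  rw [mem_CGL_iff, det_fin_one] at hA
  have h0 : (A : Matrix (Fin 1) (Fin 1) F) 0 0 ≠ 0 := by
    simpa using A.det_ne_zero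
  rcases eq_zero_or_one_of_card_eq_two h ((A : Matrix (Fin 1) (Fin 1) F) 0 0) with h' | h'
  · exact h0 h'
  · simp [h', one_add_one_eq_zero_of_card_eq_two h] at hA

theorem CGL_one_of_card_eq_three (h : Nat.card F = 3) : CGL 1 F = {1} := by
  have h2 : (1 : F) + 1 ≠ 0 := by
    have := Nat.finite_of_card_ne_zero (α := F) (by omega)
    intro h2
    have hle : (Set.univ : Set F).ncard ≤ ({0, 1} : Set F).ncard := by
      refine Set.ncard_le_ncard (fun x _ ↦ ?_)
      rcases eq_zero_or_one_or_neg_one_of_card_eq_three h x with h | h | h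
      · simp [h]
      · simp [h]
      · simp [h, neg_eq_of_add_eq_zero_left h2]
    rw [Set.ncard_univ, h, Set.ncard_pair zero_ne_one] at hle
    omega
  ext A
  rw [mem_CGL_iff, det_fin_one, Set.mem_singleton_iff]
  constructor
  · intro hA
    have h0 : (A : Matrix (Fin 1) (Fin 1) F) 0 0 ≠ 0 := by
      simpa using A.det_ne_zero
    ext i j
    rw [Subsingleton.elim i 0, Subsingleton.elim j 0]
    rcases eq_zero_or_one_or_neg_one_of_card_eq_three h ((A : Matrix (Fin 1) (Fin 1) F) 0 0)
      with h' | h' | h'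
    · exact absurd h' h0
    · simpa using h'
    · simp [h'] at hA
  · rintro rfl
    simpa using h2

theorem CGLProd_one_of_card_eq_three (h : Nat.card F = 3) (ℓ : ℕ) : CGLProd 1 F ℓ = {1} := by
  have hC := CGL_one_of_card_eq_three h
  ext A
  constructor
  · rintro ⟨B, hB, rfl⟩
    refine List.prod_eq_one fun x hx ↦ ?_
    obtain ⟨i, rfl⟩ := List.mem_ofFn.1 hx
    simpa [hC] using hB i
  · rintro rfl
    exact ⟨fun _ ↦ 1, fun _ ↦ by simp [hC], by simp⟩

theorem CGLProd_one_of_card_eq_two (h : Nat.card F = 2) {ℓ : ℕ} (hℓ : 1 ≤ ℓ) :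
    CGLProd 1 F ℓ = ∅ := by
  refine Set.eq_empty_of_forall_notMem fun A ⟨B, hB, _⟩ ↦ ?_
  have := hB ⟨0, hℓ⟩
  rw [CGL_one_of_card_eq_two h] at this
  exact this

/-- Companion matrix of `X ^ 2 + X + 1` when `1 = -1`; it has order three then. -/
def orderThree (F : Type*) [Field F] : GeneralLinearGroup (Fin 2) F :=
  GeneralLinearGroup.mkOfDetNeZero !![0, 1; 1, 1] (by simp)

theorem coe_orderThree_sq (h : Nat.card F = 2) :
    ((orderThree F ^ 2 : GeneralLinearGroup (Fin 2) F) : Matrix (Fin 2) (Fin 2) F) =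
      !![1, 1; 1, 0] := by
  rw [Units.val_pow_eq_pow_val, sq]
  change !![0, 1; 1, 1] * !![0, 1; 1, 1] = _
  ext i j
  fin_cases i <;> fin_cases j <;> simp [one_add_one_eq_zero_of_card_eq_two h]

theorem orderThree_pow_three (h : Nat.card F = 2) : orderThree F ^ 3 = 1 := by
  apply Units.ext
  rw [pow_succ, Units.val_mul, coe_orderThree_sq h]
  change !![1, 1; 1, 0] * !![0, 1; 1, 1] = _
  ext i j
  fin_cases i <;> fin_cases j <;> simp [one_add_one_eq_zero_of_card_eq_two h]

theorem CGL_two_of_card_eq_two (h : Nat.card F = 2) :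
    CGL 2 F = {orderThree F, orderThree F ^ 2} := by
  have h2 := one_add_one_eq_zero_of_card_eq_two h
  ext A
  rw [mem_CGL_iff, Set.mem_insert_iff, Set.mem_singleton_iff, Units.ext_iff, Units.ext_iff,
    coe_orderThree_sq h]
  change _ ↔ _ = !![0, 1; 1, 1] ∨ _
  have hA := A.det_ne_zero
  generalize (A : Matrix (Fin 2) (Fin 2) F) = M at hA ⊢
  rw [det_fin_two] at hA ⊢
  have key := eq_zero_or_one_of_card_eq_two h
  simp only [← Matrix.ext_iff, Fin.forall_fin_two]
  rcases key (M 0 0) with h00 | h00 <;> rcases key (M 0 1) with h01 | h01 <;>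
  rcases key (M 1 0) with h10 | h10 <;> rcases key (M 1 1) with h11 | h11 <;>
  simp_all

/-- The powers of an element `w` of order three, each as a product of any number `ℓ ≥ 2` of factors
from `{w, w ^ 2}`. -/
theorem CGLProd_two_of_card_eq_two (h : Nat.card F = 2) {ℓ : ℕ} (hℓ : 2 ≤ ℓ) :
    CGLProd 2 F ℓ = {1, orderThree F, orderThree F ^ 2} := by
  have h3 := orderThree_pow_three h
  have step (ℓ : ℕ) (A) : A ∈ CGLProd 2 F (ℓ + 1) ↔
      ∃ C ∈ CGLProd 2 F ℓ, A = orderThree F * C ∨ A = orderThree F ^ 2 * C := by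
    rw [mem_CGLProd_succ, CGL_two_of_card_eq_two h]
    simp only [Set.mem_insert_iff, Set.mem_singleton_iff, exists_eq_or_imp, exists_eq_left]
    grind
  have h4 : (orderThree F ^ 2) ^ 2 = orderThree F := by
    rw [← pow_mul, pow_succ, h3, one_mul]
  induction ℓ, hℓ using Nat.le_induction with
  | base =>
    ext A
    rw [step, CGLProd_one, CGL_two_of_card_eq_two h]
    simp only [Set.mem_insert_iff, Set.mem_singleton_iff, exists_eq_or_imp, exists_eq_left,
      ← pow_two, ← pow_succ, ← pow_succ', Nat.reduceAdd, h3, h4]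
    tauto
  | succ ℓ _ ih =>
    ext A
    rw [step, ih]
    simp only [Set.mem_insert_iff, Set.mem_singleton_iff, exists_eq_or_imp, exists_eq_left, mul_one,
      ← pow_two, ← pow_succ, ← pow_succ', Nat.reduceAdd, h3, h4]
    tauto

end Products

theorem proposition3p1 {F : Type*} [Field F] [Finite F] (q : ℕ) (hq : Nat.card F = q)
    (ℓ : ℕ) (hℓ : 1 ≤ ℓ) :
    (ℓ = 1 → ∀ d : ℕ, 1 ≤ d → CGLProd d F ℓ = CGL d F) ∧
    (2 ≤ ℓ →
      (∀ d : ℕ, 1 ≤ d → (d, q) ≠ (1, 2) → (d, q) ≠ (1, 3) → (d, q) ≠ (2, 2) →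
        CGLProd d F ℓ = Set.univ) ∧
      (q = 2 → CGLProd 1 F ℓ = ∅) ∧
      (q = 3 → CGLProd 1 F ℓ = {1}) ∧
      (q = 2 → (fun A : Matrix.GeneralLinearGroup (Fin 2) F => (A : Matrix (Fin 2) (Fin 2) F)) ''
          CGLProd 2 F ℓ = {!![1, 0; 0, 1], !![0, 1; 1, 1], !![1, 1; 1, 0]})) := by

  subst hq
  refine ⟨?_, fun hℓ2 ↦ ⟨fun d hd h12 h13 h22 ↦ ?_, fun h ↦ ?_, fun h ↦ ?_, fun h ↦ ?_⟩⟩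
  · rintro rfl d -
    exact CGLProd_one d
  · exact CGLProd_eq_univ (allShiftable_of_card rfl hd h12 h13 h22) hℓ2
  · exact CGLProd_one_of_card_eq_two h hℓ
  · exact CGLProd_one_of_card_eq_three h ℓ
  · rw [CGLProd_two_of_card_eq_two h hℓ2, Set.image_insert_eq, Set.image_pair,
      coe_orderThree_sq h, Units.val_one, Matrix.one_fin_two]
    rfl
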